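/- Let $\mathcal{X},\mathcal{W},\mathcal{Y}_1,\dots,\mathcal{Y}_K,\mathcal{U}_1,\dots,\mathcal{U}_K$ be finite alphabets. Let $(X,Y_1,\dots,Y_K)$ have an arbitrary joint pmf on $\mathcal{X}\times\mathcal{Y}_1\times\cdots\times\mathcal{Y}_K$, and let $T(u_1,\dots,u_K\mid w)$ be an arbitrary conditional pmf (a broadcast channel with input alphabet $\mathcal{W}$ and output alphabet $\mathcal{U}_k$ at receiver $k$). For positive integers $n_s,n_c$ and non-negative integers $L_1,\dots,L_K$, an $(n_s,n_c,L_1,\dots,L_K)$ list code consists of an encoder $f:\mathcal{X}^{n_s}\to\mathcal{W}^{n_c}$ and, for each $k$, a list decoder $g_k:\mathcal{U}_k^{n_c}\times\mathcal{Y}_k^{n_s}\to\{\mathcal{L}\subseteq\mathcal{X}^{n_s}:|\mathcal{L}|=L_k\}$. Here $(\mathbf{X},\mathbf{Y}_1,\dots,\mathbf{Y}_K)$ consists of $n_s$ i.i.d. copies of $(X,Y_1,\dots,Y_K)$; the codeword $\mathbf{W}=f(\mathbf{X})$ is sent over the memoryless channel, so that, given $\mathbf{W}=\mathbf{w}$ (and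 the source and side information), the outputs equal $(\mathbf{u}_1,\dots,\mathbf{u}_K)$ with probability $\prod_{i=1}^{n_c}T(u_{1,i},\dots,u_{K,i}\mid w_i)$; and receiver $k$ forms the list $\mathcal{L}_k=g_k(\mathbf{U}_k,\mathbf{Y}_k)$. Let $\kappa>0$ be rational and let $\boldsymbol{D}=(D_1,\dots,D_K)$ with $D_k\ge 0$ for all $k$. Call $(\kappa,\boldsymbol{D})$ *achievable* if for every $\epsilon>0$ and all sufficiently large $n_s,n_c$ with $n_c/n_s=\kappa$ there is an $(n_s,n_c,L_1,\dots,L_K)$ list code with $$L_k\le 2^{n_sD_k}\quad\text{and}\quad \Pr[\mathbf{X}\notin\mathcal{L}_k]\le\epsilon\qquad\text{for all }k. \tag{1}$$ Call it *weakly achievable* if for every $\epsilon>0$ and every $N$ there is a list code satisfying (1) for some $n_s,n_c\ge N$ with $n_c/n_s=\kappa$. Entropy and mutual information are in bits, and for a pmf $P_W$ on $\mathcal{W}$ the quantity $I(W;U_k)$ is computed with $(W,U_1,\dots,U_K)\sim P_W(\cdot)T(\cdot\mid\cdot)$. **Lemma.** 1. If there is a pmf $P_W$ on $\mathcal{W}$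 with $D_k>\max\{H(X|Y_k)-\kappa I(W;U_k),\,0\}$ for all $k$, then $(\kappa,\boldsymbol{D})$ is achievable. 2. If $(\kappa,\boldsymbol{D})$ is achievable, then it is weakly achievable. 3. If $(\kappa,\boldsymbol{D})$ is weakly achievable, then there is a pmf $P_W$ on $\mathcal{W}$ with $D_k\ge\max\{H(X|Y_k)-\kappa I(W;U_k),\,0\}$ for all $k$. In particular, under either notion of achievability, the strict condition is sufficient and the non-strict condition is necessary. -/

import Mathlib

namespace SWList

/-- Conditional entropy `H(A|B) = -∑ p(a,b) log₂ (p(a,b) / p(b))`, in bits, of a pair `(A, B)` with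
joint pmf `p` on finite alphabets. -/
noncomputable def condEntropy {α β : Type*} [Fintype α] [Fintype β] (p : PMF (α × β)) : ℝ :=
  -∑ a, ∑ b, (p (a, b)).toReal *
    Real.logb 2 ((p (a, b)).toReal / (p.map Prod.snd b).toReal)

/-- Mutual information `I(A;B) = ∑ p(a,b) log₂ (p(a,b) / (p(a) p(b)))`, in bits, of a pair `(A, B)`
with joint pmf `p` on finite alphabets. -/
noncomputable def mutualInfo {α β : Type*} [Fintype α] [Fintype β] (p : PMF (α × β)) : ℝ :=
  ∑ a, ∑ b, (p (a, b)).toReal *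
    Real.logb 2 ((p (a, b)).toReal / ((p.map Prod.fst a).toReal * (p.map Prod.snd b).toReal))

section Model

variable {K : ℕ} {X W : Type*} {Y U : Fin K → Type*}

/-- The joint pmf of `(X, Y_k)` when `(X, Y_1, …, Y_K) ∼ P`. -/
noncomputable def sourcePair (P : PMF (X × (∀ k, Y k))) (k : Fin K) : PMF (X × Y k) :=
  P.map fun z => (z.1, z.2 k)

/-- The joint pmf of `(W, U_k)` when `(W, U_1, …, U_K) ∼ P_W(·) T(·|·)`. -/
noncomputable def channelPair (PW : PMF W) (T : W → PMF (∀ k, U k)) (k : Fin K) :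
    PMF (W × U k) :=
  PW.bind fun w => (T w).map fun u => (w, u k)

/-- An `(ns, nc, L_1, …, L_K)` list code: an encoder `X^ns → W^nc` and, for every receiver `k`, a list
decoder that maps the channel output in `U_k^nc` and the side information in `Y_k^ns` to a subset of
`X^ns` with exactly `L_k` elements. -/
structure ListCode (X W : Type*) (Y U : Fin K → Type*) (ns nc : ℕ) (L : Fin K → ℕ) where
  encode : (Fin ns → X) → (Fin nc → W)
  decode : ∀ k, (Fin nc → U k) → (Fin ns → Y k) → {S : Finset (Fin ns → X) // S.card = L k}

variable [Fintype X] [∀ k, Fintype (Y k)] [∀ k, Fintype (U k)]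

open Classical in
/-- The probability that the source word is not in the list of receiver `k`: the `ns`
source/side-information tuples `s i` are iid with pmf `P`, and given the codeword the channel outputs
`u j` follow the memoryless law `∏ T(u j | w j)`. -/
noncomputable def ListCode.errorProb {ns nc : ℕ} {L : Fin K → ℕ} (C : ListCode X W Y U ns nc L)
    (P : PMF (X × (∀ k, Y k))) (T : W → PMF (∀ k, U k)) (k : Fin K) : ℝ :=
  ∑ s : Fin ns → X × (∀ k, Y k), ∑ u : Fin nc → (∀ k, U k),
    if (fun i => (s i).1) ∈ (C.decode k (fun j => u j k) (fun i => (s i).2 k)).1 then 0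
    else (∏ i, (P (s i)).toReal) * ∏ j, (T (C.encode (fun i => (s i).1) j) (u j)).toReal

/-- At block lengths `ns`, `nc` there is a list code with list sizes `L_k ≤ 2^(ns D_k)` and error
probability at most `ε` at every receiver. -/
def HasGoodCode (P : PMF (X × (∀ k, Y k))) (T : W → PMF (∀ k, U k)) (D : Fin K → ℝ)
    (ε : ℝ) (ns nc : ℕ) : Prop :=
  ∃ (L : Fin K → ℕ) (C : ListCode X W Y U ns nc L),
    ∀ k, (L k : ℝ) ≤ (2 : ℝ) ^ ((ns : ℝ) * D k) ∧ C.errorProb P T k ≤ ε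

/-- `(κ, D)` is achievable: for every `ε > 0` there is a good list code at all sufficiently large
block lengths with `nc / ns = κ`. -/
def Achievable (P : PMF (X × (∀ k, Y k))) (T : W → PMF (∀ k, U k)) (κ : ℚ) (D : Fin K → ℝ) :
    Prop :=
  ∀ ε : ℝ, 0 < ε → ∃ N : ℕ, ∀ ns nc : ℕ, N ≤ ns → N ≤ nc → (nc : ℚ) / ns = κ →
    HasGoodCode P T D ε ns nc

/-- The weaker form of achievability: for every `ε > 0` there are good list codes at some arbitrarily
large block lengths with `nc / ns = κ`. -/
def WeaklyAchievable (P : PMF (X × (∀ k, Y k))) (T : W → PMF (∀ k, U k)) (κ : ℚ)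
    (D : Fin K → ℝ) : Prop :=
  ∀ ε : ℝ, 0 < ε → ∀ N : ℕ, ∃ ns nc : ℕ, N ≤ ns ∧ N ≤ nc ∧ (nc : ℚ) / ns = κ ∧
    HasGoodCode P T D ε ns nc

end Model

end SWList

/-!
Everything is computed in nats, on real-valued laws in the standard simplex.

*Sufficiency.* Draw the codewords of all source words independently from `P_W^nc`, and let a
receiver list the words `x` whose score `p(x|y) V(u|w) / q(u)`, with `w` the codeword of `x`,
exceeds a threshold `τ`, unless there are too many of them. The scores of the competing words have
mean total at most `1`, so by Markov's inequality the list overflows `L` words with probability at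
most `1 / (τ L)`, while the true word scores below `τ` with vanishing probability by the law of
large numbers. Averaging over codebooks, some codebook serves all receivers at once.

*Necessity.* For a fixed code, Gibbs' inequality compares the score with a law favouring the listed
words, which bounds `H(X^ns|Y^ns)` by a relative entropy between channel outputs, the logarithm of
the list size and a Fano term. Taking the reference output law to be a product law turns the
relative entropy into `nc * I(W;U)` at the average law of a codeword letter. These laws do not depend
on the receiver, and compactness of the simplex yields a limiting one.
-/

namespace SWList

open Finset Filter Real
open scoped Topology

section ProductLaw

variable {ι A : Type*} [Fintype ι]

/-- The product law `∏ i, p i` of a family of laws on `A`, as a function on `ι → A`. -/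
def piLaw (p : ι → A → ℝ) (f : ι → A) : ℝ := ∏ i, p i (f i)

variable [DecidableEq ι] [Fintype A] {p : ι → A → ℝ}

lemma piLaw_mem_stdSimplex (hp : ∀ i, p i ∈ stdSimplex ℝ A) :
    piLaw p ∈ stdSimplex ℝ (ι → A) := by
  refine ⟨fun f => prod_nonneg fun i _ => (hp i).1 _, ?_⟩
  simp_rw [piLaw, ← Fintype.prod_sum, (hp _).2, prod_const_one]

lemma sum_piLaw_mul_prod (hp : ∀ i, ∑ a, p i a = 1) (s : Finset ι) (g : ι → A → ℝ) :
    ∑ f, piLaw p f * ∏ i ∈ s, g i (f i) = ∏ i ∈ s, ∑ a, p i a * g i a := by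
  simp_rw [piLaw, ← Fintype.prod_ite_mem s, ← prod_mul_distrib]
  rw [← Fintype.prod_sum fun i a => p i a * if i ∈ s then g i a else 1]
  refine prod_congr rfl fun i _ => ?_
  split_ifs <;> simp [hp]

lemma sum_piLaw_mul_apply (hp : ∀ i, ∑ a, p i a = 1) (i : ι) (g : A → ℝ) :
    ∑ f, piLaw p f * g (f i) = ∑ a, p i a * g a := by
  simpa using sum_piLaw_mul_prod hp {i} fun _ => g

lemma sum_piLaw_mul_apply_mul_apply (hp : ∀ i, ∑ a, p i a = 1) {i j : ι} (hij : i ≠ j)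
    (g h : A → ℝ) :
    ∑ f, piLaw p f * (g (f i) * h (f j)) = (∑ a, p i a * g a) * ∑ a, p j a * h a := by
  simpa [prod_pair hij, hij.symm] using
    sum_piLaw_mul_prod hp {i, j} fun l => if l = i then g else h

lemma sum_piLaw_mul_sum (hp : ∀ i, ∑ a, p i a = 1) (g : ι → A → ℝ) :
    ∑ f, piLaw p f * ∑ i, g i (f i) = ∑ i, ∑ a, p i a * g i a := by
  simp_rw [mul_sum]
  rw [sum_comm]
  exact sum_congr rfl fun i _ => sum_piLaw_mul_apply hp i (g i)

lemma sum_piLaw_mul_log_prod (hp : ∀ i, ∑ a, p i a = 1) {s : ι → A → ℝ}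
    (hs : ∀ i a, p i a ≠ 0 → s i a ≠ 0) :
    ∑ f, piLaw p f * log (∏ i, s i (f i)) = ∑ i, ∑ a, p i a * log (s i a) := by
  rw [← sum_piLaw_mul_sum hp fun i a => log (s i a)]
  refine sum_congr rfl fun f _ => ?_
  rcases eq_or_ne (piLaw p f) 0 with hf | hf
  · rw [hf, zero_mul, zero_mul]
  · rw [log_prod fun i _ => hs i _ (prod_ne_zero_iff.1 hf i (mem_univ i))]

end ProductLaw

section LowerTail

variable {A : Type*} [Fintype A] {p : A → ℝ}

lemma exists_pos_sum_mul_exp_lt_one (hp : ∑ a, p a = 1) {g : A → ℝ} {c : ℝ}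
    (hc : c < ∑ a, p a * g a) : ∃ t > 0, ∑ a, p a * exp (-t * (g a - c)) < 1 := by
  have hderiv : HasDerivAt (fun t : ℝ => ∑ a, p a * exp (-t * (g a - c)))
      (c - ∑ a, p a * g a) 0 := by
    convert! HasDerivAt.fun_sum fun a (_ : a ∈ univ) =>
      (((hasDerivAt_id' (0 : ℝ)).neg.mul_const (g a - c)).exp.const_mul (p a)) using 1
    simp [neg_add_eq_sub, mul_sub, sum_sub_distrib, ← sum_mul, hp]
  have hslope := (hasDerivAt_iff_tendsto_slope.1 hderiv).eventually_lt_const (sub_neg.2 hc)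
  obtain ⟨t, ht, ht0⟩ := ((hslope.filter_mono (nhdsGT_le_nhdsNE 0)).and self_mem_nhdsWithin).exists
  refine ⟨t, ht0, ?_⟩
  rw [slope_def_field, sub_zero, div_lt_iff₀ ht0] at ht
  simpa [hp] using ht

lemma sum_piLaw_lowerTail_le_pow (hp : ∀ a, 0 ≤ p a) {s : A → ℝ}
    (hs : ∀ a, p a ≠ 0 → 0 < s a) (c : ℝ) {t : ℝ} (ht : 0 ≤ t) (n : ℕ) :
    ∑ f : Fin n → A, piLaw (fun _ => p) f * (if ∏ i, s (f i) < exp (n * c) then 1 else 0) ≤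
      (∑ a, p a * exp (-t * (log (s a) - c))) ^ n := by
  rw [sum_pow', Fintype.piFinset_univ]
  refine sum_le_sum fun f _ => ?_
  rw [piLaw, prod_mul_distrib]
  rcases eq_or_ne (∏ i, p (f i)) 0 with hf | hf
  · simp [hf]
  refine mul_le_mul_of_nonneg_left ?_ (prod_nonneg fun i _ => hp _)
  rw [← exp_sum, ← mul_sum, sum_sub_distrib]
  have hspos : ∀ i, 0 < s (f i) := fun i => hs _ (prod_ne_zero_iff.1 hf i (mem_univ i))
  split_ifs with hlt
  · have hlog : ∑ i, log (s (f i)) < n * c := by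
      rw [← log_prod fun i _ => (hspos i).ne']
      exact (log_lt_iff_lt_exp (prod_pos fun i _ => hspos i)).2 hlt
    refine one_le_exp (mul_nonneg_of_nonpos_of_nonpos (neg_nonpos.2 ht) ?_)
    simpa using hlog.le
  · exact (exp_pos _).le

lemma tendsto_sum_piLaw_lowerTail (hp : p ∈ stdSimplex ℝ A) {s : A → ℝ}
    (hs : ∀ a, p a ≠ 0 → 0 < s a) {c : ℝ} (hc : c < ∑ a, p a * log (s a)) :
    Tendsto (fun n : ℕ => ∑ f : Fin n → A,
      piLaw (fun _ => p) f * (if ∏ i, s (f i) < exp (n * c) then 1 else 0)) atTop (𝓝 0) := by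
  obtain ⟨t, ht, hlt⟩ := exists_pos_sum_mul_exp_lt_one hp.2 hc
  refine squeeze_zero (fun n => ?_)
    (fun n => sum_piLaw_lowerTail_le_pow hp.1 hs c ht.le n)
    (tendsto_pow_atTop_nhds_zero_of_lt_one ?_ hlt)
  · exact sum_nonneg fun f _ => mul_nonneg (prod_nonneg fun i _ => hp.1 _)
      (by split_ifs <;> simp)
  · exact sum_nonneg fun a _ => mul_nonneg (hp.1 a) (exp_pos _).le

end LowerTail

section Information

variable {X Y W U : Type*}

/-- The conditional law `p(x|y)`, evaluated at `z = (x, y)`, of a joint law `p`; it is `0` where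
the marginal `p(y)` vanishes. -/
noncomputable def posterior [Fintype X] (p : X × Y → ℝ) (z : X × Y) : ℝ :=
  p z / ∑ x, p (x, z.2)

/-- The conditional entropy `H(X|Y)`, in nats, of a pair with joint law `p`. -/
noncomputable def condEnt [Fintype X] [Fintype Y] (p : X × Y → ℝ) : ℝ :=
  -∑ z, p z * log (posterior p z)

/-- The relative entropy `D(P‖Q)`, in nats; it is meaningful only where `P` is absolutely
continuous with respect to `Q`. -/
noncomputable def relEntropy [Fintype U] (P Q : U → ℝ) : ℝ :=
  ∑ u, P u * log (P u / Q u)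

/-- The output law of the channel `V` when its input has law `v`. -/
def outLaw [Fintype W] (V : W → U → ℝ) (v : W → ℝ) (u : U) : ℝ :=
  ∑ w, v w * V w u

/-- The mutual information, in nats, between input and output of the channel `V` when the input
has law `v`. -/
noncomputable def info [Fintype W] [Fintype U] (V : W → U → ℝ) (v : W → ℝ) : ℝ :=
  ∑ w, v w * relEntropy (V w) (outLaw V v)

/-- The joint law of an input with law `v` and the output of the channel `V`. -/
def jointLaw (v : W → ℝ) (V : W → U → ℝ) (b : W × U) : ℝ :=
  v b.1 * V b.1 b.2

lemma posterior_nonneg [Fintype X] {p : X × Y → ℝ} (hp : ∀ z, 0 ≤ p z) (z : X × Y) :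
    0 ≤ posterior p z :=
  div_nonneg (hp z) (sum_nonneg fun _ _ => hp _)

lemma posterior_pos [Fintype X] {p : X × Y → ℝ} (hp : ∀ z, 0 ≤ p z) {z : X × Y} (hz : p z ≠ 0) :
    0 < posterior p z :=
  have hpos := (hp z).lt_of_ne' hz
  div_pos hpos (sum_pos' (fun _ _ => hp _) ⟨z.1, mem_univ _, hpos⟩)

lemma sum_posterior_le_one [Fintype X] (p : X × Y → ℝ) (y : Y) :
    ∑ x, posterior p (x, y) ≤ 1 := by
  simp_rw [posterior, ← sum_div]
  exact div_self_le_one _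

variable {V : W → U → ℝ} {v : W → ℝ}

lemma sum_jointLaw_mul [Fintype W] [Fintype U] (g : W × U → ℝ) :
    ∑ b, jointLaw v V b * g b = ∑ w, v w * ∑ u, V w u * g (w, u) := by
  simp_rw [Fintype.sum_prod_type, jointLaw, mul_sum, mul_assoc]

lemma jointLaw_mem_stdSimplex [Fintype W] [Fintype U] (hv : v ∈ stdSimplex ℝ W)
    (hV : ∀ w, V w ∈ stdSimplex ℝ U) : jointLaw v V ∈ stdSimplex ℝ (W × U) := by
  refine ⟨fun b => mul_nonneg (hv.1 _) ((hV _).1 _), ?_⟩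
  simp_rw [Fintype.sum_prod_type, jointLaw, ← mul_sum, (hV _).2, mul_one, hv.2]

lemma outLaw_mem_stdSimplex [Fintype W] [Fintype U] (hV : ∀ w, V w ∈ stdSimplex ℝ U)
    (hv : v ∈ stdSimplex ℝ W) : outLaw V v ∈ stdSimplex ℝ U := by
  refine ⟨fun u => sum_nonneg fun w _ => mul_nonneg (hv.1 w) ((hV w).1 u), ?_⟩
  simp_rw [outLaw]
  rw [sum_comm]
  simp_rw [← mul_sum, (hV _).2, mul_one, hv.2]

lemma outLaw_pos [Fintype W] (hV : ∀ w u, 0 ≤ V w u) (hv : ∀ w, 0 ≤ v w) {w : W} {u : U}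
    (hw : v w ≠ 0) (hu : V w u ≠ 0) : 0 < outLaw V v u :=
  sum_pos' (fun w _ => mul_nonneg (hv w) (hV w u))
    ⟨w, mem_univ w, mul_pos ((hv w).lt_of_ne' hw) ((hV w u).lt_of_ne' hu)⟩

lemma info_eq_sub [Fintype W] [Fintype U] (hV : ∀ w u, 0 ≤ V w u) (hv : ∀ w, 0 ≤ v w) :
    info V v = ∑ w, v w * ∑ u, V w u * log (V w u) -
      ∑ u, outLaw V v u * log (outLaw V v u) := by
  have hout : ∑ u, outLaw V v u * log (outLaw V v u) =
      ∑ w, v w * ∑ u, V w u * log (outLaw V v u) := by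
    simp_rw [mul_sum, ← mul_assoc]
    rw [sum_comm]
    exact sum_congr rfl fun u _ => sum_mul _ _ _
  rw [hout, info, ← sum_sub_distrib]
  refine sum_congr rfl fun w _ => ?_
  rcases eq_or_ne (v w) 0 with hw | hw
  · simp [hw]
  rw [← mul_sub, ← sum_sub_distrib, relEntropy]
  congr 1
  refine sum_congr rfl fun u _ => ?_
  rcases eq_or_ne (V w u) 0 with hu | hu
  · simp [hu]
  · rw [log_div hu (outLaw_pos hV hv hw hu).ne', mul_sub]

lemma continuousOn_info [Fintype W] [Fintype U] (hV : ∀ w u, 0 ≤ V w u) :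
    ContinuousOn (info V) (stdSimplex ℝ W) := by
  have hcont : Continuous fun v : W → ℝ => ∑ w, v w * ∑ u, V w u * log (V w u) -
      ∑ u, outLaw V v u * log (outLaw V v u) := by
    refine Continuous.sub (by fun_prop) (continuous_finsetSum _ fun u _ => ?_)
    exact continuous_mul_log.comp (by unfold outLaw; fun_prop)
  exact hcont.continuousOn.congr fun v hv => info_eq_sub hV hv.1

/-- **Gibbs' inequality**, for the likelihood ratio `R` of a subprobability against `P`. -/
lemma sum_mul_log_nonpos {Ω : Type*} [Fintype Ω] {P R : Ω → ℝ} (hP : P ∈ stdSimplex ℝ Ω)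
    (hR : ∀ ω, P ω ≠ 0 → 0 < R ω) (hPR : ∑ ω, P ω * R ω ≤ 1) :
    ∑ ω, P ω * log (R ω) ≤ 0 := by
  have hlog : ∀ ω, P ω * log (R ω) ≤ P ω * R ω - P ω := fun ω => by
    rcases eq_or_ne (P ω) 0 with hω | hω
    · simp [hω]
    · linarith [mul_le_mul_of_nonneg_left (log_le_sub_one_of_pos (hR ω hω)) (hP.1 ω)]
  calc ∑ ω, P ω * log (R ω) ≤ ∑ ω, (P ω * R ω - P ω) := sum_le_sum fun ω _ => hlog ω
    _ ≤ 0 := by rw [sum_sub_distrib, hP.2]; linarith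

end Information

section ListDecoding

variable {X Y W U : Type*} [Fintype X]

/-- The score `p(x|y) V(u|w) / q(u)` of a source word `x` with codeword `w`, given the side
information `y` and the channel output `u`. -/
noncomputable def score (p : X × Y → ℝ) (V : W → U → ℝ) (q : U → ℝ) (x : X) (y : Y) (w : W)
    (u : U) : ℝ :=
  posterior p (x, y) * (V w u / q u)

open Classical in
/-- The subprobability on `X` with which Fano's inequality for a list `S` of at most `L` words
compares the posterior: it favours the words in `S` by a factor `|X|`. -/
noncomputable def fanoWeight (L : ℝ) (S : Finset X) (x : X) : ℝ :=
  (2 * L)⁻¹ * if x ∈ S then 1 else (Fintype.card X : ℝ)⁻¹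

lemma fanoWeight_pos {L : ℝ} (hL : 0 < L) (S : Finset X) (x : X) : 0 < fanoWeight L S x := by
  have hX : 0 < Fintype.card X := Fintype.card_pos_iff.2 ⟨x⟩
  unfold fanoWeight
  split_ifs <;> positivity

lemma sum_fanoWeight_le_one {L : ℝ} (hL : 1 ≤ L) {S : Finset X} (hS : (#S : ℝ) ≤ L) :
    ∑ x, fanoWeight L S x ≤ 1 := by
  classical
  have hinside : ∑ x, (if x ∈ S then (1 : ℝ) else 0) ≤ L := by simpa using hS
  have hcard : ∑ _x : X, (Fintype.card X : ℝ)⁻¹ ≤ 1 := by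
    simpa using mul_inv_le_one
  have hle : ∀ x, (if x ∈ S then (1 : ℝ) else (Fintype.card X : ℝ)⁻¹) ≤
      (if x ∈ S then 1 else 0) + (Fintype.card X : ℝ)⁻¹ := fun x => by
    split_ifs <;> simp
  have hsum := sum_le_sum fun x (_ : x ∈ univ) => hle x
  rw [sum_add_distrib] at hsum
  simp_rw [fanoWeight, ← mul_sum]
  rw [inv_mul_le_iff₀ (by positivity)]
  linarith

open Classical in
lemma log_fanoWeight {L : ℝ} (hL : 0 < L) (S : Finset X) (x : X) :
    log (fanoWeight L S x) =
      -(log 2 + log L) - (if x ∈ S then 0 else 1) * log (Fintype.card X) := by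
  have hX : (Fintype.card X : ℝ) ≠ 0 := Nat.cast_ne_zero.2 (Fintype.card_pos_iff.2 ⟨x⟩).ne'
  unfold fanoWeight
  split_ifs
  · rw [mul_one, log_inv, log_mul two_ne_zero hL.ne']
    ring
  · rw [log_mul (by positivity) (inv_ne_zero hX), log_inv, log_inv, log_mul two_ne_zero hL.ne']
    ring

variable {p : X × Y → ℝ} {V : W → U → ℝ} {q : U → ℝ}

lemma score_pos {x : X} {y : Y} {w : W} {u : U} (hpost : 0 < posterior p (x, y))
    (hratio : 0 < V w u / q u) : 0 < score p V q x y w u :=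
  mul_pos hpost hratio

open Classical in
lemma log_fanoWeight_div_score {L : ℝ} (hL : 0 < L) (S : Finset X) {x : X} {y : Y} {w : W} {u : U}
    (hpost : 0 < posterior p (x, y)) (hratio : 0 < V w u / q u) :
    log (fanoWeight L S x / score p V q x y w u) =
      -(log 2 + log L) - (if x ∈ S then 0 else 1) * log (Fintype.card X) -
        log (posterior p (x, y)) - log (V w u / q u) := by
  rw [score, log_div (fanoWeight_pos hL S x).ne' (mul_pos hpost hratio).ne', log_fanoWeight hL,
    log_mul hpost.ne' hratio.ne']
  ring

variable [Fintype Y] [Fintype U]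

lemma sum_mul_fanoWeight_div_score_le_one (hp : p ∈ stdSimplex ℝ (X × Y))
    (hq : q ∈ stdSimplex ℝ U) {enc : X → W}
    {dec : U → Y → Finset X} {L : ℝ} (hL : 1 ≤ L) (hdec : ∀ u y, (#(dec u y) : ℝ) ≤ L) :
    ∑ b, jointLaw p (fun z => V (enc z.1)) b *
      (fanoWeight L (dec b.2 b.1.2) b.1.1 / score p V q b.1.1 b.1.2 (enc b.1.1) b.2) ≤ 1 := by
  have hterm : ∀ z : X × Y, ∀ u, p z * V (enc z.1) u *
      (fanoWeight L (dec u z.2) z.1 / score p V q z.1 z.2 (enc z.1) u) ≤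
        (∑ x, p (x, z.2)) * (q u * fanoWeight L (dec u z.2) z.1) := fun z u => by
    rcases eq_or_ne (p z * V (enc z.1) u) 0 with h0 | h0
    · rw [h0, zero_mul]
      exact mul_nonneg (sum_nonneg fun x _ => hp.1 _)
        (mul_nonneg (hq.1 u) (fanoWeight_pos (by linarith) _ _).le)
    · obtain ⟨hz, hu⟩ := mul_ne_zero_iff.1 h0
      refine le_of_eq ?_
      rw [score, posterior]
      field_simp
  calc _ ≤ ∑ b : (X × Y) × U, (∑ x, p (x, b.1.2)) *
          (q b.2 * fanoWeight L (dec b.2 b.1.2) b.1.1) := sum_le_sum fun b _ => hterm b.1 b.2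
    _ = ∑ y, (∑ x, p (x, y)) * ∑ u, q u * ∑ x, fanoWeight L (dec u y) x := by
        simp_rw [Fintype.sum_prod_type, mul_sum]
        rw [sum_comm]
        exact sum_congr rfl fun y _ => sum_comm
    _ ≤ ∑ y, (∑ x, p (x, y)) * ∑ u, q u := by
        gcongr with y _ u
        · exact sum_nonneg fun x _ => hp.1 _
        · exact mul_le_of_le_one_right (hq.1 u) (sum_fanoWeight_le_one hL (hdec u y))
    _ = 1 := by
        rw [← sum_mul, hq.2, mul_one, sum_comm, ← Fintype.sum_prod_type, hp.2]

open Classical in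
/-- The probability that a source word is missing from the list of a receiver, when the word and
the side information have joint law `p` and the codeword is sent once over the channel `V`. -/
noncomputable def listErrorProb (p : X × Y → ℝ) (V : W → U → ℝ) (enc : X → W)
    (dec : U → Y → Finset X) : ℝ :=
  ∑ z, p z * ∑ u, V (enc z.1) u * if z.1 ∈ dec u z.2 then 0 else 1

/-- **Fano's inequality** for list decoding. The auxiliary output law `q` stands in for the true
one, at the price of a larger relative entropy. -/
lemma condEnt_le_of_listErrorProb (hp : p ∈ stdSimplex ℝ (X × Y))
    (hV : ∀ w, V w ∈ stdSimplex ℝ U) (hq : q ∈ stdSimplex ℝ U) {enc : X → W}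
    (hpq : ∀ z u, p z ≠ 0 → V (enc z.1) u ≠ 0 → q u ≠ 0)
    {dec : U → Y → Finset X} {L : ℝ} (hL : 1 ≤ L) (hdec : ∀ u y, (#(dec u y) : ℝ) ≤ L) :
    condEnt p ≤ ∑ z, p z * relEntropy (V (enc z.1)) q + (log 2 + log L) +
      listErrorProb p V enc dec * log (Fintype.card X) := by
  classical
  have hL0 : 0 < L := by linarith
  have hP := jointLaw_mem_stdSimplex hp fun z : X × Y => hV (enc z.1)
  have hpos : ∀ b : (X × Y) × U, jointLaw p (fun z => V (enc z.1)) b ≠ 0 →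
      0 < posterior p b.1 ∧ 0 < V (enc b.1.1) b.2 / q b.2 := fun b hb => by
    obtain ⟨hz, hu⟩ := mul_ne_zero_iff.1 hb
    exact ⟨posterior_pos hp.1 hz, div_pos (((hV _).1 _).lt_of_ne' hu)
      ((hq.1 _).lt_of_ne' (hpq _ _ hz hu))⟩
  have hR : ∀ b : (X × Y) × U, jointLaw p (fun z => V (enc z.1)) b ≠ 0 →
      0 < fanoWeight L (dec b.2 b.1.2) b.1.1 / score p V q b.1.1 b.1.2 (enc b.1.1) b.2 :=
    fun b hb => div_pos (fanoWeight_pos hL0 _ _) (score_pos (hpos b hb).1 (hpos b hb).2)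
  have hGibbs := sum_mul_log_nonpos hP hR (sum_mul_fanoWeight_div_score_le_one hp hq hL hdec)
  have hsplit : ∀ b : (X × Y) × U, jointLaw p (fun z => V (enc z.1)) b *
        log (fanoWeight L (dec b.2 b.1.2) b.1.1 / score p V q b.1.1 b.1.2 (enc b.1.1) b.2) =
      jointLaw p (fun z => V (enc z.1)) b * (-(log 2 + log L) -
        (if b.1.1 ∈ dec b.2 b.1.2 then 0 else 1) * log (Fintype.card X) -
        log (posterior p b.1) - log (V (enc b.1.1) b.2 / q b.2)) := fun b => by
    rcases eq_or_ne (jointLaw p (fun z => V (enc z.1)) b) 0 with hb | hb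
    · rw [hb, zero_mul, zero_mul]
    · rw [log_fanoWeight_div_score hL0 _ (hpos b hb).1 (hpos b hb).2]
  simp_rw [hsplit, mul_sub, sum_sub_distrib, ← mul_assoc, ← sum_mul, hP.2, one_mul] at hGibbs
  simp_rw [sum_jointLaw_mul, ← sum_mul, (hV _).2, one_mul] at hGibbs
  simp only [condEnt, relEntropy, listErrorProb]
  linarith

end ListDecoding

section RandomCoding

variable {X Y W U : Type*} [Fintype X]

/-- The source words whose score under the codebook `F` is at least `τ`. -/
noncomputable def candidates (p : X × Y → ℝ) (V : W → U → ℝ) (q : U → ℝ) (τ : ℝ) (F : X → W)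
    (u : U) (y : Y) : Finset X :=
  {x | τ ≤ score p V q x y (F x) u}

/-- The list decoder that returns the candidates at threshold `τ`, giving up with the empty list
if there are more than `L` of them. -/
noncomputable def thresholdDecoder (p : X × Y → ℝ) (V : W → U → ℝ) (q : U → ℝ) (τ : ℝ) (L : ℕ)
    (F : X → W) (u : U) (y : Y) : Finset X :=
  if #(candidates p V q τ F u y) ≤ L then candidates p V q τ F u y else ∅

variable {p : X × Y → ℝ} {V : W → U → ℝ} {q : U → ℝ} {v : W → ℝ} {τ : ℝ} {L : ℕ}

lemma card_thresholdDecoder_le (F : X → W) (u : U) (y : Y) :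
    #(thresholdDecoder p V q τ L F u y) ≤ L := by
  unfold thresholdDecoder
  split_ifs with h
  · exact h
  · simp

lemma miss_thresholdDecoder_le [DecidableEq X] (hL : 0 < L) (F : X → W) (x : X) (y : Y) (u : U) :
    (if x ∈ thresholdDecoder p V q τ L F u y then (0 : ℝ) else 1) ≤
      (if score p V q x y (F x) u < τ then 1 else 0) +
        (∑ x' ∈ univ.erase x, if τ ≤ score p V q x' y (F x') u then 1 else 0) / L := by
  have hothers : (0 : ℝ) ≤ ∑ x' ∈ univ.erase x, if τ ≤ score p V q x' y (F x') u then 1 else 0 :=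
    sum_nonneg fun x' _ => by split_ifs <;> simp
  have hquot := div_nonneg hothers (Nat.cast_nonneg L)
  by_cases hx : score p V q x y (F x) u < τ
  · rw [if_pos hx]
    split_ifs <;> linarith
  have hmem : x ∈ candidates p V q τ F u y := by simpa [candidates] using hx
  rw [if_neg hx, zero_add]
  split_ifs with hlist
  · exact hquot
  have hcard : L < #(candidates p V q τ F u y) := by
    by_contra! hle
    exact hlist (by rwa [thresholdDecoder, if_pos hle])
  have herase : ∑ x' ∈ univ.erase x, (if τ ≤ score p V q x' y (F x') u then (1 : ℝ) else 0) =
      (#((candidates p V q τ F u y).erase x) : ℝ) := by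
    rw [sum_boole, filter_erase, candidates]
  rw [herase, one_le_div (by positivity), Nat.cast_le, card_erase_of_mem hmem]
  omega

variable [Fintype W]

lemma sum_mul_score_le (hp : ∀ z, 0 ≤ p z) (x : X) (y : Y) (u : U) :
    ∑ w, v w * score p V (outLaw V v) x y w u ≤ posterior p (x, y) := by
  have hfactor : ∑ w, v w * score p V (outLaw V v) x y w u =
      posterior p (x, y) * (outLaw V v u / outLaw V v u) := by
    simp_rw [score, mul_left_comm (v _), ← mul_sum, mul_div_assoc', ← sum_div]
    rw [mul_div_assoc]
    rfl
  rw [hfactor]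
  exact mul_le_of_le_one_right (posterior_nonneg hp _) (div_self_le_one _)

/-- Markov's inequality for the score of a word whose codeword is independent of the output. -/
lemma sum_mul_ite_le_score_le (hp : ∀ z, 0 ≤ p z) (hV : ∀ w u, 0 ≤ V w u) (hv : ∀ w, 0 ≤ v w)
    (hτ : 0 < τ) (x : X) (y : Y) (u : U) :
    ∑ w, v w * (if τ ≤ score p V (outLaw V v) x y w u then 1 else 0) ≤
      posterior p (x, y) / τ := by
  have hscore : ∀ w, 0 ≤ score p V (outLaw V v) x y w u := fun w =>
    mul_nonneg (posterior_nonneg hp _)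
      (div_nonneg (hV w u) (sum_nonneg fun w _ => mul_nonneg (hv w) (hV w u)))
  have hmarkov : ∀ w, (if τ ≤ score p V (outLaw V v) x y w u then (1 : ℝ) else 0) ≤
      score p V (outLaw V v) x y w u / τ := fun w => by
    split_ifs with h
    · rwa [one_le_div hτ]
    · exact div_nonneg (hscore w) hτ.le
  calc _ ≤ ∑ w, v w * (score p V (outLaw V v) x y w u / τ) :=
        sum_le_sum fun w _ => mul_le_mul_of_nonneg_left (hmarkov w) (hv w)
    _ = (∑ w, v w * score p V (outLaw V v) x y w u) / τ := by
        simp_rw [mul_div_assoc', ← sum_div]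
    _ ≤ posterior p (x, y) / τ := by gcongr; exact sum_mul_score_le hp x y u

lemma sum_ite_score_lt_le [Fintype Y] [Fintype U] (hp : p ∈ stdSimplex ℝ (X × Y))
    (hV : ∀ w, V w ∈ stdSimplex ℝ U) (hv : v ∈ stdSimplex ℝ W) {τ₁ τ₂ : ℝ} (hτ₂ : 0 ≤ τ₂) :
    ∑ z, p z * ∑ b, jointLaw v V b *
        (if score p V q z.1 z.2 b.1 b.2 < τ₁ * τ₂ then 1 else 0) ≤
      ∑ z, p z * (if posterior p z < τ₁ then 1 else 0) +
        ∑ b, jointLaw v V b * (if V b.1 b.2 / q b.2 < τ₂ then 1 else 0) := by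
  have hjoint := jointLaw_mem_stdSimplex hv hV
  have hsplit : ∀ z : X × Y, ∀ b : W × U,
      (if score p V q z.1 z.2 b.1 b.2 < τ₁ * τ₂ then (1 : ℝ) else 0) ≤
        (if posterior p z < τ₁ then 1 else 0) + if V b.1 b.2 / q b.2 < τ₂ then 1 else 0 :=
    fun z b => by
    by_cases h₁ : posterior p z < τ₁
    · rw [if_pos h₁]
      split_ifs <;> norm_num
    by_cases h₂ : V b.1 b.2 / q b.2 < τ₂
    · rw [if_pos h₂]
      split_ifs <;> norm_num
    · have hscore : τ₁ * τ₂ ≤ score p V q z.1 z.2 b.1 b.2 :=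
        mul_le_mul (not_lt.1 h₁) (not_lt.1 h₂) hτ₂ (posterior_nonneg hp.1 _)
      rw [if_neg hscore.not_gt, if_neg h₁, if_neg h₂, add_zero]
  calc _ ≤ ∑ z, p z * ∑ b, jointLaw v V b * ((if posterior p z < τ₁ then 1 else 0) +
          if V b.1 b.2 / q b.2 < τ₂ then 1 else 0) :=
        sum_le_sum fun z _ => mul_le_mul_of_nonneg_left (sum_le_sum fun b _ =>
          mul_le_mul_of_nonneg_left (hsplit z b) (hjoint.1 b)) (hp.1 z)
    _ = _ := by
        simp_rw [mul_add, sum_add_distrib, ← sum_mul, mul_add, sum_add_distrib, ← sum_mul,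
          hjoint.2, hp.2, one_mul]

variable [DecidableEq X]

lemma sum_codebook_competitors_le (hp : ∀ z, 0 ≤ p z) (hV : ∀ w u, 0 ≤ V w u)
    (hv : v ∈ stdSimplex ℝ W) (hτ : 0 < τ) (x : X) (y : Y) (u : U) :
    ∑ F, piLaw (fun _ : X => v) F * (V (F x) u * ∑ x' ∈ univ.erase x,
        if τ ≤ score p V (outLaw V v) x' y (F x') u then 1 else 0) ≤ outLaw V v u / τ := by
  have hout : 0 ≤ outLaw V v u := sum_nonneg fun w _ => mul_nonneg (hv.1 w) (hV w u)
  calc _ = ∑ x' ∈ univ.erase x, outLaw V v u *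
        ∑ w, v w * (if τ ≤ score p V (outLaw V v) x' y w u then 1 else 0) := by
        simp_rw [mul_sum (univ.erase x)]
        rw [sum_comm]
        refine sum_congr rfl fun x' hx' => ?_
        exact sum_piLaw_mul_apply_mul_apply (fun _ => hv.2) (ne_of_mem_erase hx').symm
          (fun w => V w u) fun w => if τ ≤ score p V (outLaw V v) x' y w u then 1 else 0
    _ ≤ ∑ x', outLaw V v u * (posterior p (x', y) / τ) := by
        refine (sum_le_sum fun x' _ => mul_le_mul_of_nonneg_left
          (sum_mul_ite_le_score_le hp hV hv.1 hτ x' y u) hout).trans ?_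
        exact sum_le_sum_of_subset_of_nonneg (subset_univ _) fun x' _ _ =>
          mul_nonneg hout (div_nonneg (posterior_nonneg hp _) hτ.le)
    _ = outLaw V v u / τ * ∑ x', posterior p (x', y) := by
        rw [mul_sum]
        exact sum_congr rfl fun x' _ => by ring
    _ ≤ outLaw V v u / τ :=
        mul_le_of_le_one_right (div_nonneg hout hτ.le) (sum_posterior_le_one p y)

lemma sum_codebook_miss_le (hp : ∀ z, 0 ≤ p z) (hV : ∀ w u, 0 ≤ V w u)
    (hv : v ∈ stdSimplex ℝ W) (hτ : 0 < τ) (hL : 0 < L) (x : X) (y : Y) (u : U) :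
    ∑ F, piLaw (fun _ : X => v) F * (V (F x) u *
        if x ∈ thresholdDecoder p V (outLaw V v) τ L F u y then 0 else 1) ≤
      ∑ w, v w * (V w u * if score p V (outLaw V v) x y w u < τ then 1 else 0) +
        outLaw V v u * (τ * L)⁻¹ := by
  have hF : ∀ F : X → W, 0 ≤ piLaw (fun _ => v) F := fun F => prod_nonneg fun _ _ => hv.1 _
  calc _ ≤ ∑ F, piLaw (fun _ : X => v) F * (V (F x) u *
          ((if score p V (outLaw V v) x y (F x) u < τ then 1 else 0) + (∑ x' ∈ univ.erase x,
            if τ ≤ score p V (outLaw V v) x' y (F x') u then 1 else 0) / L)) :=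
        sum_le_sum fun F _ => mul_le_mul_of_nonneg_left
          (mul_le_mul_of_nonneg_left (miss_thresholdDecoder_le hL F x y u) (hV _ u)) (hF F)
    _ = ∑ w, v w * (V w u * if score p V (outLaw V v) x y w u < τ then 1 else 0) +
          (∑ F, piLaw (fun _ : X => v) F * (V (F x) u * ∑ x' ∈ univ.erase x,
            if τ ≤ score p V (outLaw V v) x' y (F x') u then 1 else 0)) / L := by
        simp_rw [mul_add, sum_add_distrib, mul_div_assoc', ← sum_div]
        rw [sum_piLaw_mul_apply (fun _ => hv.2) x
          fun w => V w u * if score p V (outLaw V v) x y w u < τ then 1 else 0]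
    _ ≤ _ := by
        rw [mul_inv, ← mul_assoc, ← div_eq_mul_inv, ← div_eq_mul_inv]
        gcongr
        exact sum_codebook_competitors_le hp hV hv hτ x y u

variable [Fintype Y] [Fintype U]

/-- The average is over codebooks whose codewords are independent with law `v`. -/
lemma sum_codebook_listErrorProb_le (hp : p ∈ stdSimplex ℝ (X × Y))
    (hV : ∀ w, V w ∈ stdSimplex ℝ U) (hv : v ∈ stdSimplex ℝ W) {τ₁ τ₂ : ℝ} (hτ₁ : 0 < τ₁)
    (hτ₂ : 0 < τ₂) (hL : 0 < L) :
    ∑ F, piLaw (fun _ : X => v) F *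
        listErrorProb p V F (thresholdDecoder p V (outLaw V v) (τ₁ * τ₂) L F) ≤
      ∑ z, p z * (if posterior p z < τ₁ then 1 else 0) +
        ∑ b, jointLaw v V b * (if V b.1 b.2 / outLaw V v b.2 < τ₂ then 1 else 0) +
        (τ₁ * τ₂ * L)⁻¹ := by
  have hout := outLaw_mem_stdSimplex hV hv
  calc _ = ∑ z, p z * ∑ u, ∑ F, piLaw (fun _ : X => v) F * (V (F z.1) u *
          if z.1 ∈ thresholdDecoder p V (outLaw V v) (τ₁ * τ₂) L F u z.2 then 0 else 1) := by
        simp_rw [listErrorProb, mul_sum]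
        rw [sum_comm]
        refine sum_congr rfl fun z _ => ?_
        rw [sum_comm]
        refine sum_congr rfl fun u _ => sum_congr rfl fun F _ => ?_
        rw [mul_left_comm]
        congr!
    _ ≤ ∑ z, p z * ∑ u, (∑ w, v w * (V w u *
          if score p V (outLaw V v) z.1 z.2 w u < τ₁ * τ₂ then 1 else 0) +
            outLaw V v u * (τ₁ * τ₂ * L)⁻¹) :=
        sum_le_sum fun z _ => mul_le_mul_of_nonneg_left (sum_le_sum fun u _ =>
          sum_codebook_miss_le hp.1 (fun w => (hV w).1) hv (mul_pos hτ₁ hτ₂) hL _ _ u) (hp.1 z)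
    _ = ∑ z, p z * ∑ b, jointLaw v V b *
          (if score p V (outLaw V v) z.1 z.2 b.1 b.2 < τ₁ * τ₂ then 1 else 0) +
            (τ₁ * τ₂ * L)⁻¹ := by
        simp_rw [sum_jointLaw_mul, sum_add_distrib, ← sum_mul, hout.2, mul_add, sum_add_distrib,
          ← sum_mul, hp.2, one_mul]
        congr! 3 with z
        rw [sum_comm]
        simp_rw [mul_sum]
    _ ≤ _ := by
        gcongr
        exact sum_ite_score_lt_le hp hV hv hτ₂.le

end RandomCoding

/-- A weighted average bound on several costs forces one point at which all of them are small. -/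
lemma exists_forall_le_sum_of_sum_mul_le {Ω κ : Type*} [Fintype Ω] [Fintype κ] {c : Ω → ℝ}
    (hc : c ∈ stdSimplex ℝ Ω) {g : κ → Ω → ℝ} (hg : ∀ k ω, 0 ≤ g k ω) {ε : κ → ℝ}
    (h : ∀ k, ∑ ω, c ω * g k ω ≤ ε k) : ∃ ω, ∀ k, g k ω ≤ ∑ k, ε k := by
  by_contra! hbig
  obtain ⟨ω₀, hω₀⟩ : ∃ ω, 0 < c ω := by
    by_contra! hle
    linarith [hc.2, sum_nonpos fun ω (_ : ω ∈ univ) => hle ω]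
  have hlt : ∀ ω, ∑ k, ε k < ∑ k, g k ω := fun ω => by
    obtain ⟨k, hk⟩ := hbig ω
    exact hk.trans_le (single_le_sum (fun k _ => hg k ω) (mem_univ k))
  have : ∑ k, ε k < ∑ k, ε k :=
    calc ∑ k, ε k = ∑ ω, c ω * ∑ k, ε k := by rw [← sum_mul, hc.2, one_mul]
      _ < ∑ ω, c ω * ∑ k, g k ω :=
          sum_lt_sum (fun ω _ => mul_le_mul_of_nonneg_left (hlt ω).le (hc.1 ω))
            ⟨ω₀, mem_univ _, mul_lt_mul_of_pos_left (hlt ω₀) hω₀⟩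
      _ = ∑ k, ∑ ω, c ω * g k ω := by simp_rw [mul_sum]; exact sum_comm
      _ ≤ ∑ k, ε k := sum_le_sum fun k _ => h k
  exact this.false

section Blocks

variable {ι J X Y W U : Type*} [Fintype ι] [Fintype J]

/-- The joint law of a block of independent copies, indexed by `ι`, of a pair with joint law `p`;
the block is encoded as a pair of words so that `posterior` and `listErrorProb` apply to it. -/
def blockLaw (p : X × Y → ℝ) (z : (ι → X) × (ι → Y)) : ℝ :=
  ∏ i, p (z.1 i, z.2 i)

/-- The memoryless extension of the channel `V` to words indexed by `J`. -/
def blockChannel (V : W → U → ℝ) (w : J → W) : (J → U) → ℝ :=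
  piLaw fun j => V (w j)

variable {p : X × Y → ℝ} {V : W → U → ℝ} {v : W → ℝ}

lemma jointLaw_blockChannel :
    jointLaw (piLaw fun _ : J => v) (blockChannel V) = blockLaw (jointLaw v V) := by
  funext b
  exact prod_mul_distrib.symm

variable [DecidableEq ι] [DecidableEq J]

lemma sum_blockLaw_mul [Fintype X] [Fintype Y] (g : (ι → X) × (ι → Y) → ℝ) :
    ∑ z, blockLaw p z * g z =
      ∑ f : ι → X × Y, piLaw (fun _ => p) f * g (fun i => (f i).1, fun i => (f i).2) :=
  (Fintype.sum_equiv (Equiv.arrowProdEquivProdArrow ι (fun _ => X) fun _ => Y) _ _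
    fun _ => rfl).symm

lemma blockLaw_mem_stdSimplex [Fintype X] [Fintype Y] (hp : p ∈ stdSimplex ℝ (X × Y)) :
    (blockLaw p : (ι → X) × (ι → Y) → ℝ) ∈ stdSimplex ℝ _ := by
  refine ⟨fun z => prod_nonneg fun i _ => hp.1 _, ?_⟩
  have hsum := sum_blockLaw_mul (ι := ι) (p := p) fun _ => 1
  simp only [mul_one] at hsum
  rw [hsum, (piLaw_mem_stdSimplex fun _ => hp).2]

lemma blockChannel_mem_stdSimplex [Fintype U] (hV : ∀ w, V w ∈ stdSimplex ℝ U) (w : J → W) :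
    blockChannel V w ∈ stdSimplex ℝ (J → U) :=
  piLaw_mem_stdSimplex fun _ => hV _

lemma sum_blockLaw_snd [Fintype Y] (x : ι → X) :
    ∑ y : ι → Y, blockLaw p (x, y) = ∏ i, ∑ y, p (x i, y) :=
  (Fintype.prod_sum fun i y => p (x i, y)).symm

lemma posterior_blockLaw [Fintype X] (z : (ι → X) × (ι → Y)) :
    posterior (blockLaw p) z = ∏ i, posterior p (z.1 i, z.2 i) := by
  simp_rw [posterior, prod_div_distrib, Fintype.prod_sum]
  rfl

lemma condEnt_blockLaw [Fintype X] [Fintype Y] (hp : p ∈ stdSimplex ℝ (X × Y)) :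
    condEnt (blockLaw p : (ι → X) × (ι → Y) → ℝ) = Fintype.card ι * condEnt p := by
  rw [condEnt, sum_blockLaw_mul]
  simp_rw [posterior_blockLaw]
  rw [sum_piLaw_mul_log_prod (s := fun _ => posterior p) (fun _ => hp.2)
    fun _ _ hz => (posterior_pos hp.1 hz).ne']
  simp [condEnt]

lemma relEntropy_piLaw [Fintype U] {P Q : J → U → ℝ} (hP : ∀ j, ∑ u, P j u = 1)
    (hPQ : ∀ j u, P j u ≠ 0 → Q j u ≠ 0) :
    relEntropy (piLaw P) (piLaw Q) = ∑ j, relEntropy (P j) (Q j) := by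
  simp_rw [relEntropy, ← sum_piLaw_mul_log_prod hP fun j u hu => div_ne_zero hu (hPQ j u hu),
    prod_div_distrib]
  rfl

lemma outLaw_blockChannel [Fintype W] :
    outLaw (blockChannel V) (piLaw fun _ : J => v) = piLaw fun _ => outLaw V v := by
  funext u
  simp_rw [outLaw, blockChannel, piLaw, ← prod_mul_distrib]
  exact (Fintype.prod_sum fun j w => v w * V w (u j)).symm

lemma tendsto_sum_blockLaw_ite_posterior_lt [Fintype X] [Fintype Y]
    (hp : p ∈ stdSimplex ℝ (X × Y)) {c : ℝ} (hc : c < -condEnt p) :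
    Tendsto (fun n : ℕ => ∑ z : (Fin n → X) × (Fin n → Y), blockLaw p z *
      (if posterior (blockLaw p) z < exp (n * c) then 1 else 0)) atTop (𝓝 0) := by
  simp_rw [sum_blockLaw_mul, posterior_blockLaw]
  refine tendsto_sum_piLaw_lowerTail hp (fun _ => posterior_pos hp.1) ?_
  rwa [condEnt, neg_neg] at hc

lemma tendsto_sum_blockLaw_ite_ratio_lt [Fintype W] [Fintype U] (hV : ∀ w, V w ∈ stdSimplex ℝ U)
    (hv : v ∈ stdSimplex ℝ W) {c : ℝ} (hc : c < info V v) :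
    Tendsto (fun n : ℕ => ∑ b : (Fin n → W) × (Fin n → U),
      jointLaw (piLaw fun _ => v) (blockChannel V) b *
        (if blockChannel V b.1 b.2 / outLaw (blockChannel V) (piLaw fun _ => v) b.2 < exp (n * c)
          then 1 else 0)) atTop (𝓝 0) := by
  simp_rw [jointLaw_blockChannel, outLaw_blockChannel, sum_blockLaw_mul, blockChannel, piLaw,
    ← prod_div_distrib]
  refine tendsto_sum_piLaw_lowerTail (s := fun b => V b.1 b.2 / outLaw V v b.2)
    (jointLaw_mem_stdSimplex hv hV) (fun b hb => ?_) ?_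
  · obtain ⟨hw, hu⟩ := mul_ne_zero_iff.1 hb
    exact div_pos (((hV _).1 _).lt_of_ne' hu) (outLaw_pos (fun w => (hV w).1) hv.1 hw hu)
  · rwa [sum_jointLaw_mul]

end Blocks

section BlockConverse

variable {Ω J Y W U : Type*} [Fintype Ω] [Fintype J] {P : Ω → ℝ}

open Classical in
/-- The law of a letter picked uniformly at random from the codeword `enc a`, when the source
word `a` has law `P`. -/
noncomputable def letterLaw (P : Ω → ℝ) (enc : Ω → J → W) (w : W) : ℝ :=
  (∑ a, P a * ∑ j, if enc a j = w then 1 else 0) / Fintype.card J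

lemma sum_letterLaw_mul [Fintype W] (enc : Ω → J → W) (g : W → ℝ) :
    ∑ w, letterLaw P enc w * g w = (∑ a, P a * ∑ j, g (enc a j)) / Fintype.card J := by
  classical
  have hcount : ∀ a, ∑ w, (∑ j, if enc a j = w then 1 else 0) * g w = ∑ j, g (enc a j) :=
    fun a => by
    simp_rw [sum_mul]
    rw [sum_comm]
    simp
  simp_rw [letterLaw, div_mul_eq_mul_div, ← sum_div, ← hcount, sum_mul (s := (univ : Finset Ω)),
    mul_assoc]
  rw [sum_comm]
  simp_rw [mul_sum (s := (univ : Finset W))]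

lemma letterLaw_nonneg (hP : ∀ a, 0 ≤ P a) (enc : Ω → J → W) (w : W) : 0 ≤ letterLaw P enc w :=
  div_nonneg (sum_nonneg fun a _ => mul_nonneg (hP a)
    (sum_nonneg fun j _ => by split_ifs <;> simp)) (Nat.cast_nonneg _)

lemma letterLaw_mem_stdSimplex [Fintype W] [Nonempty J] (hP : P ∈ stdSimplex ℝ Ω)
    (enc : Ω → J → W) : letterLaw P enc ∈ stdSimplex ℝ W := by
  refine ⟨letterLaw_nonneg hP.1 enc, ?_⟩
  have hsum := sum_letterLaw_mul (P := P) enc fun _ => 1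
  simpa [← sum_mul, hP.2] using hsum

lemma letterLaw_apply_ne_zero (hP : ∀ a, 0 ≤ P a) (enc : Ω → J → W) {a : Ω} (ha : P a ≠ 0)
    (j : J) : letterLaw P enc (enc a j) ≠ 0 := by
  classical
  have hcount : ∀ b, 0 ≤ ∑ i, if enc b i = enc a j then (1 : ℝ) else 0 := fun b =>
    sum_nonneg fun i _ => by split_ifs <;> simp
  have hone : 0 < ∑ i, if enc a i = enc a j then (1 : ℝ) else 0 :=
    sum_pos' (fun i _ => by split_ifs <;> simp) ⟨j, mem_univ j, by simp⟩
  have hJ : 0 < Fintype.card J := Fintype.card_pos_iff.2 ⟨j⟩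
  exact (div_pos (sum_pos' (fun b _ => mul_nonneg (hP b) (hcount b))
    ⟨a, mem_univ a, mul_pos ((hP a).lt_of_ne' ha) hone⟩) (Nat.cast_pos.2 hJ)).ne'

variable [Fintype W] {V : W → U → ℝ}

lemma outLaw_letterLaw_pos (hP : ∀ a, 0 ≤ P a) (hV : ∀ w u, 0 ≤ V w u) (enc : Ω → J → W) {a : Ω}
    (ha : P a ≠ 0) {j : J} {u : U} (hu : V (enc a j) u ≠ 0) :
    0 < outLaw V (letterLaw P enc) u :=
  outLaw_pos hV (letterLaw_nonneg hP enc) (letterLaw_apply_ne_zero hP enc ha j) hu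

variable [Fintype Y] [Fintype U] [DecidableEq J] [Nonempty J] {p : Ω × Y → ℝ}

lemma sum_mul_relEntropy_blockChannel (hP : ∀ a, 0 ≤ P a) (hpP : ∀ a, ∑ y, p (a, y) = P a)
    (hV : ∀ w, V w ∈ stdSimplex ℝ U) (enc : Ω → J → W) :
    ∑ z, p z * relEntropy (blockChannel V (enc z.1))
        (piLaw fun _ => outLaw V (letterLaw P enc)) =
      Fintype.card J * info V (letterLaw P enc) := by
  have hword : ∀ a, P a * relEntropy (blockChannel V (enc a))
      (piLaw fun _ => outLaw V (letterLaw P enc)) =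
        P a * ∑ j, relEntropy (V (enc a j)) (outLaw V (letterLaw P enc)) := fun a => by
    rcases eq_or_ne (P a) 0 with ha | ha
    · rw [ha, zero_mul, zero_mul]
    · rw [blockChannel, relEntropy_piLaw (fun j => (hV _).2)
        fun j u hu => (outLaw_letterLaw_pos hP (fun w => (hV w).1) enc ha hu).ne']
  have hJ : (Fintype.card J : ℝ) ≠ 0 := Nat.cast_ne_zero.2 Fintype.card_ne_zero
  rw [info, sum_letterLaw_mul, mul_div_cancel₀ _ hJ, Fintype.sum_prod_type]
  simp_rw [← sum_mul, hpP, hword]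

/-- The converse for one block: the letters of the codeword may be treated as identically
distributed, with their average law. -/
lemma condEnt_le_info_letterLaw (hp : p ∈ stdSimplex ℝ (Ω × Y))
    (hpP : ∀ a, ∑ y, p (a, y) = P a) (hV : ∀ w, V w ∈ stdSimplex ℝ U) (enc : Ω → J → W)
    {dec : (J → U) → Y → Finset Ω} {L : ℝ} (hL : 1 ≤ L) (hdec : ∀ u y, (#(dec u y) : ℝ) ≤ L) :
    condEnt p ≤ Fintype.card J * info V (letterLaw P enc) + (log 2 + log L) +
      listErrorProb p (blockChannel V) enc dec * log (Fintype.card Ω) := by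
  have hP : P ∈ stdSimplex ℝ Ω := by
    refine ⟨fun a => hpP a ▸ sum_nonneg fun y _ => hp.1 _, ?_⟩
    simp_rw [← hpP, ← Fintype.sum_prod_type, hp.2]
  have hletter := letterLaw_mem_stdSimplex hP enc
  rw [← sum_mul_relEntropy_blockChannel hP.1 hpP hV enc]
  refine condEnt_le_of_listErrorProb hp (blockChannel_mem_stdSimplex hV)
    (piLaw_mem_stdSimplex fun _ => outLaw_mem_stdSimplex hV hletter) (fun z u hz hu => ?_) hL hdec
  have hPz : P z.1 ≠ 0 := by
    rw [← hpP]
    exact (sum_pos' (f := fun y => p (z.1, y)) (fun y _ => hp.1 _)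
      ⟨z.2, mem_univ _, (hp.1 z).lt_of_ne' hz⟩).ne'
  exact prod_ne_zero_iff.2 fun j hj =>
    (outLaw_letterLaw_pos hP.1 (fun w => (hV w).1) enc hPz (prod_ne_zero_iff.1 hu j hj)).ne'

end BlockConverse

section Asymptotics

lemma inv_exp_mul_exp_mul_floor_exp_le (a b : ℝ) {x : ℝ} (hx : 0 ≤ x) :
    (exp a * exp b * ⌊exp x⌋₊)⁻¹ ≤ 2 * exp (-(a + b + x)) := by
  have hfloor : exp x / 2 ≤ ⌊exp x⌋₊ := by
    have hone : (1 : ℝ) ≤ ⌊exp x⌋₊ := by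
      exact_mod_cast Nat.le_floor (by simpa using hx)
    linarith [Nat.lt_floor_add_one (exp x)]
  calc (exp a * exp b * ⌊exp x⌋₊)⁻¹ ≤ (exp a * exp b * (exp x / 2))⁻¹ := by gcongr
    _ = 2 * exp (-(a + b + x)) := by
        rw [exp_neg, exp_add, exp_add]
        field_simp

variable {X Y W U : Type*} [Fintype X] [DecidableEq X] [Fintype Y] [Fintype W] [Fintype U]
  {p : X × Y → ℝ} {V : W → U → ℝ} {v : W → ℝ}

lemma eventually_exists_sum_codebook_le (hp : p ∈ stdSimplex ℝ (X × Y))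
    (hV : ∀ w, V w ∈ stdSimplex ℝ U) (hv : v ∈ stdSimplex ℝ W) {κ r : ℝ}
    (hr : 0 ≤ r) (hgap : condEnt p - κ * info V v < r) {ε : ℝ} (hε : 0 < ε) :
    ∀ᶠ n : ℕ × ℕ in atTop, (n.2 : ℝ) = κ * n.1 → ∃ τ,
      ∑ F : (Fin n.1 → X) → Fin n.2 → W, piLaw (fun _ => piLaw fun _ => v) F *
        listErrorProb (blockLaw p) (blockChannel V) F (thresholdDecoder (blockLaw p)
          (blockChannel V) (outLaw (blockChannel V) (piLaw fun _ => v)) τ ⌊exp (n.1 * r)⌋₊ F) ≤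
        ε := by
  obtain ⟨δ, hδ, hδgap⟩ : ∃ δ > 0, (1 + κ) * δ < r - (condEnt p - κ * info V v) :=
    exists_pos_mul_lt (sub_pos.2 hgap) _
  set c₁ := -condEnt p - δ with hc₁
  set c₂ := info V v - δ with hc₂
  have hexponent : 0 < c₁ + κ * c₂ + r := by rw [hc₁, hc₂]; linarith
  have hpost := tendsto_sum_blockLaw_ite_posterior_lt hp (sub_lt_self (-condEnt p) hδ)
  have hratio := tendsto_sum_blockLaw_ite_ratio_lt hV hv (sub_lt_self (info V v) hδ)
  have hlist : Tendsto (fun n : ℕ => 2 * exp (-(n * (c₁ + κ * c₂ + r)))) atTop (𝓝 0) := by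
    simpa using (tendsto_exp_neg_atTop_nhds_zero.comp
      (tendsto_natCast_atTop_atTop.atTop_mul_const hexponent)).const_mul 2
  have hsum := ((hpost.comp tendsto_fst).add (hratio.comp tendsto_snd)).add (hlist.comp tendsto_fst)
  rw [prod_atTop_atTop_eq, add_zero, add_zero] at hsum
  filter_upwards [hsum.eventually_le_const hε] with n hn hn₂
  refine ⟨exp (n.1 * c₁) * exp (n.2 * c₂), (sum_codebook_listErrorProb_le
    (blockLaw_mem_stdSimplex hp) (blockChannel_mem_stdSimplex hV)
    (piLaw_mem_stdSimplex fun _ => hv) (exp_pos _) (exp_pos _) ?_).trans (le_trans ?_ hn)⟩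
  · exact Nat.floor_pos.2 (one_le_exp (by positivity))
  · refine add_le_add le_rfl ((inv_exp_mul_exp_mul_floor_exp_le _ _ (by positivity)).trans_eq ?_)
    simp only [Function.comp_apply]
    rw [hn₂]
    ring_nf

end Asymptotics

section Receivers

lemma listErrorProb_nonneg {X Y W U : Type*} [Fintype X] [Fintype Y] [Fintype U] {p : X × Y → ℝ}
    {V : W → U → ℝ} (hp : ∀ z, 0 ≤ p z) (hV : ∀ w u, 0 ≤ V w u) (enc : X → W)
    (dec : U → Y → Finset X) : 0 ≤ listErrorProb p V enc dec :=
  sum_nonneg fun _ _ => mul_nonneg (hp _) (sum_nonneg fun _ _ => mul_nonneg (hV _ _)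
    (by split_ifs <;> simp))

lemma listErrorProb_anti {X Y W U : Type*} [Fintype X] [Fintype Y] [Fintype U] {p : X × Y → ℝ}
    {V : W → U → ℝ} (hp : ∀ z, 0 ≤ p z) (hV : ∀ w u, 0 ≤ V w u) {enc : X → W}
    {dec dec' : U → Y → Finset X} (h : ∀ u y, dec u y ⊆ dec' u y) :
    listErrorProb p V enc dec' ≤ listErrorProb p V enc dec := by
  unfold listErrorProb
  gcongr with z _ u
  · exact hp z
  · exact hV _ u
  · by_cases hz : z.1 ∈ dec u z.2
    · rw [if_pos hz, if_pos (h u z.2 hz)]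
    · rw [if_neg hz]
      split_ifs <;> simp

variable {X W K : Type*} [Fintype X] [Fintype W] {Y U : K → Type*} [∀ k, Fintype (Y k)]
  [∀ k, Fintype (U k)] {p : ∀ k, X × Y k → ℝ} {V : ∀ k, W → U k → ℝ}

/-- There is a list code for source words of length `n` and codewords of length `m` with list rates
`r k` in nats and error probability at most `ε` at every receiver. It depends only on the joint law
`p k` of a source letter and its side information and on the channel `V k`, for each receiver `k`;
its lists may have fewer than `exp (n * r k)` words. -/
def HasBlockCode (p : ∀ k, X × Y k → ℝ) (V : ∀ k, W → U k → ℝ) (r : K → ℝ) (ε : ℝ) (n m : ℕ) :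
    Prop :=
  ∃ (enc : (Fin n → X) → Fin m → W) (dec : ∀ k, (Fin m → U k) → (Fin n → Y k) →
    Finset (Fin n → X)), ∀ k, (∀ u y, (#(dec k u y) : ℝ) ≤ exp (n * r k)) ∧
      listErrorProb (blockLaw (p k)) (blockChannel (V k)) enc (dec k) ≤ ε

/-- Random coding for finitely many receivers: the errors of a random codebook at the receivers
are small on average, so some codebook makes their sum small. -/
lemma eventually_hasBlockCode [Finite K] {v : W → ℝ} (hp : ∀ k, p k ∈ stdSimplex ℝ (X × Y k))
    (hV : ∀ k w, V k w ∈ stdSimplex ℝ (U k)) (hv : v ∈ stdSimplex ℝ W) {κ : ℝ} {r : K → ℝ}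
    (hr : ∀ k, 0 ≤ r k) (hgap : ∀ k, condEnt (p k) - κ * info (V k) v < r k)
    {ε : ℝ} (hε : 0 < ε) :
    ∀ᶠ n : ℕ × ℕ in atTop, (n.2 : ℝ) = κ * n.1 → HasBlockCode p V r ε n.1 n.2 := by
  classical
  cases nonempty_fintype K
  have hshare : 0 < ε / (Fintype.card K + 1) := by positivity
  filter_upwards [eventually_all.2 fun k =>
    eventually_exists_sum_codebook_le (hp k) (hV k) hv (hr k) (hgap k) hshare] with n hn hn₂
  choose τ hτ using fun k => hn k hn₂
  obtain ⟨F, hF⟩ := exists_forall_le_sum_of_sum_mul_le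
    (piLaw_mem_stdSimplex fun _ => piLaw_mem_stdSimplex fun _ => hv)
    (fun k F => listErrorProb_nonneg (blockLaw_mem_stdSimplex (hp k)).1
      (fun w => (blockChannel_mem_stdSimplex (hV k) w).1) F _) hτ
  refine ⟨F, fun k => _, fun k => ⟨fun u y => ?_, (hF k).trans ?_⟩⟩
  · exact (Nat.cast_le.2 (card_thresholdDecoder_le F u y)).trans (Nat.floor_le (exp_pos _).le)
  · rw [sum_const, card_univ, nsmul_eq_mul, mul_div_assoc', div_le_iff₀ (by positivity)]
    linarith

lemma HasBlockCode.exists_mul_condEnt_sub_le {μ : X → ℝ} {r : K → ℝ} {ε : ℝ} {n m : ℕ} [NeZero m]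
    (hcode : HasBlockCode p V r ε n m) (hp : ∀ k, p k ∈ stdSimplex ℝ (X × Y k))
    (hpμ : ∀ k x, ∑ y, p k (x, y) = μ x) (hμ : μ ∈ stdSimplex ℝ X)
    (hV : ∀ k w, V k w ∈ stdSimplex ℝ (U k)) (hr : ∀ k, 0 ≤ r k) :
    ∃ v ∈ stdSimplex ℝ W, ∀ k, n * condEnt (p k) - m * info (V k) v ≤
      n * r k + log 2 + ε * (n * log (Fintype.card X)) := by
  classical
  obtain ⟨enc, dec, hdec⟩ := hcode
  refine ⟨letterLaw (piLaw fun _ => μ) enc,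
    letterLaw_mem_stdSimplex (piLaw_mem_stdSimplex fun _ => hμ) enc, fun k => ?_⟩
  have hblock := condEnt_le_info_letterLaw (blockLaw_mem_stdSimplex (hp k)) (P := piLaw fun _ => μ)
    (fun x => by simp_rw [sum_blockLaw_snd, hpμ, piLaw]) (hV k) enc
    (one_le_exp (mul_nonneg n.cast_nonneg (hr k))) (hdec k).1
  have herror := mul_le_mul_of_nonneg_right (hdec k).2
    (mul_nonneg n.cast_nonneg (log_natCast_nonneg (Fintype.card X)))
  rw [condEnt_blockLaw (hp k), log_exp] at hblock
  simp only [Fintype.card_fin, Fintype.card_fun, Nat.cast_pow, log_pow] at hblock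
  linarith

end Receivers

section Limit

lemma exists_forall_le_of_forall_exists_le_add {ι E : Type*} [TopologicalSpace E] {s : Set E}
    (hs : IsCompact s) {f : ι → E → ℝ} (hf : ∀ i, ContinuousOn (f i) s) {c : ι → ℝ}
    (h : ∀ ε > 0, ∃ x ∈ s, ∀ i, f i x ≤ c i + ε) : ∃ x ∈ s, ∀ i, f i x ≤ c i := by
  choose u hus hu using fun n : ℕ => h (1 / ((n : ℝ) + 1)) Nat.one_div_pos_of_nat
  obtain ⟨x, hxs, hx⟩ := hs.exists_mapClusterPt (f := atTop) (u := u)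
    (tendsto_principal.2 (Eventually.of_forall hus))
  refine ⟨x, hxs, fun i => le_of_forall_pos_le_add fun ε hε => ?_⟩
  by_contra! hlt
  have hnear : ∀ᶠ y in 𝓝 x, y ∈ s → c i + ε < f i y :=
    eventually_nhdsWithin_iff.1 ((hf i x hxs).eventually_const_lt hlt)
  have hsmall : ∀ᶠ n : ℕ in atTop, 1 / ((n : ℝ) + 1) < ε :=
    tendsto_one_div_add_atTop_nhds_zero_nat.eventually_lt_const hε
  obtain ⟨n, hn, hnε⟩ := ((hx.frequently hnear).and_eventually hsmall).exists
  linarith [hn (hus n), hu n i]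

variable {X W K : Type*} [Fintype X] [Fintype W] {Y U : K → Type*} [∀ k, Fintype (Y k)]
  [∀ k, Fintype (U k)] {p : ∀ k, X × Y k → ℝ} {V : ∀ k, W → U k → ℝ}

lemma exists_condEnt_sub_le_of_hasBlockCode {μ : X → ℝ} {κ : ℝ} {r : K → ℝ}
    (hp : ∀ k, p k ∈ stdSimplex ℝ (X × Y k)) (hpμ : ∀ k x, ∑ y, p k (x, y) = μ x)
    (hμ : μ ∈ stdSimplex ℝ X) (hV : ∀ k w, V k w ∈ stdSimplex ℝ (U k)) (hr : ∀ k, 0 ≤ r k)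
    (hcode : ∀ ε > 0, ∀ N : ℕ, ∃ n ≥ N, ∃ m ≥ N, (m : ℝ) = κ * n ∧ HasBlockCode p V r ε n m) :
    ∃ v ∈ stdSimplex ℝ W, ∀ k, condEnt (p k) - κ * info (V k) v ≤ r k := by
  refine exists_forall_le_of_forall_exists_le_add (isCompact_stdSimplex ℝ W)
    (fun k => continuousOn_const.sub ((continuousOn_info fun w => (hV k w).1).const_mul κ))
    fun δ hδ => ?_
  obtain ⟨ε, hε, hεδ⟩ := exists_pos_mul_lt hδ (log 2 + log (Fintype.card X))
  obtain ⟨N, hN⟩ := exists_nat_gt ε⁻¹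
  obtain ⟨n, hn, m, hm, hmn, hcode⟩ := hcode ε hε N
  have hN0 : 0 < N := Nat.cast_pos.1 ((inv_pos.2 hε).trans hN)
  have hn0 : (0 : ℝ) < n := Nat.cast_pos.2 (hN0.trans_le hn)
  have : NeZero m := ⟨(hN0.trans_le hm).ne'⟩
  obtain ⟨v, hv, hbound⟩ := hcode.exists_mul_condEnt_sub_le hp hpμ hμ hV hr
  have hnε : 1 ≤ n * ε := (inv_le_iff_one_le_mul₀ hε).1 (hN.le.trans (Nat.cast_le.2 hn))
  refine ⟨v, hv, fun k => le_of_mul_le_mul_left ?_ hn0⟩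
  calc n * (condEnt (p k) - κ * info (V k) v)
      = n * condEnt (p k) - m * info (V k) v := by rw [hmn]; ring
    _ ≤ n * r k + 1 * log 2 + ε * (n * log (Fintype.card X)) := by
        rw [one_mul]
        exact hbound k
    _ ≤ n * r k + n * ε * log 2 + ε * (n * log (Fintype.card X)) := by gcongr
    _ = n * (r k + (log 2 + log (Fintype.card X)) * ε) := by ring
    _ ≤ n * (r k + δ) := by gcongr

end Limit

section Law

variable {A B : Type*}

/-- The probabilities of a pmf, as real numbers. -/
noncomputable def law (p : PMF A) (a : A) : ℝ :=
  (p a).toReal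

variable [Fintype A]

lemma law_mem_stdSimplex (p : PMF A) : law p ∈ stdSimplex ℝ A := by
  refine ⟨fun a => ENNReal.toReal_nonneg, ?_⟩
  simp_rw [law]
  rw [← ENNReal.toReal_sum fun a _ => p.apply_ne_top a, ← tsum_fintype (L := .unconditional A),
    p.tsum_coe, ENNReal.toReal_one]

lemma exists_law_eq {v : A → ℝ} (hv : v ∈ stdSimplex ℝ A) : ∃ p : PMF A, law p = v := by
  refine ⟨PMF.ofFintype (fun a => ENNReal.ofReal (v a)) ?_, ?_⟩
  · rw [← ENNReal.ofReal_sum_of_nonneg fun a _ => hv.1 a, hv.2, ENNReal.ofReal_one]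
  · funext a
    rw [law, PMF.ofFintype_apply, ENNReal.toReal_ofReal (hv.1 a)]

lemma law_map [DecidableEq B] (p : PMF A) (φ : A → B) (b : B) :
    law (p.map φ) b = ∑ a, if φ a = b then law p a else 0 := by
  rw [law, PMF.map_apply, tsum_fintype, ENNReal.toReal_sum fun a _ => by
    split_ifs <;> simp [p.apply_ne_top]]
  refine sum_congr rfl fun a _ => ?_
  simp only [eq_comm (a := b), apply_ite ENNReal.toReal, ENNReal.toReal_zero, law]

lemma law_map_fst [Fintype B] (p : PMF (A × B)) (a : A) :
    law (p.map Prod.fst) a = ∑ b, law p (a, b) := by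
  classical
  rw [law_map, Fintype.sum_prod_type, sum_comm]
  simp

lemma law_map_snd [Fintype B] (p : PMF (A × B)) (b : B) :
    law (p.map Prod.snd) b = ∑ a, law p (a, b) := by
  classical
  rw [law_map, Fintype.sum_prod_type]
  simp

lemma sum_piLaw_map_mul {ι : Type*} [Fintype ι] [DecidableEq ι] [Fintype B] (p : ι → PMF A)
    (φ : A → B) (G : (ι → B) → ℝ) :
    ∑ g, piLaw (fun i => law ((p i).map φ)) g * G g =
      ∑ f, piLaw (fun i => law (p i)) f * G fun i => φ (f i) := by
  classical
  simp_rw [piLaw, law_map, Fintype.prod_sum, sum_mul]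
  rw [sum_comm]
  refine sum_congr rfl fun f _ => ?_
  rw [sum_eq_single fun i => φ (f i)]
  · simp
  · intro g _ hg
    obtain ⟨i, hi⟩ := Function.ne_iff.1 hg
    rw [prod_eq_zero (mem_univ i) (if_neg hi.symm), zero_mul]
  · simp

lemma condEntropy_eq_condEnt_div [Fintype B] (p : PMF (A × B)) :
    condEntropy p = condEnt (law p) / log 2 := by
  have hmarginal : ∀ b, (p.map Prod.snd b).toReal = ∑ a, law p (a, b) := law_map_snd p
  simp_rw [condEntropy, condEnt, posterior, hmarginal, logb, neg_div, Fintype.sum_prod_type,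
    sum_div, mul_div_assoc]
  rfl

end Law

section Model

variable {K : ℕ} {X W : Type*} {Y U : Fin K → Type*}

/-- The transition probabilities of the channel to receiver `k`. -/
noncomputable def chan (T : W → PMF (∀ k, U k)) (k : Fin K) (w : W) : U k → ℝ :=
  law ((T w).map fun t => t k)

variable [∀ k, Fintype (U k)]

lemma chan_mem_stdSimplex (T : W → PMF (∀ k, U k)) (k : Fin K) (w : W) :
    chan T k w ∈ stdSimplex ℝ (U k) :=
  law_mem_stdSimplex _

lemma law_channelPair [Fintype W] (PW : PMF W) (T : W → PMF (∀ k, U k)) (k : Fin K) :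
    law (channelPair PW T k) = jointLaw (law PW) (chan T k) := by
  classical
  funext ⟨w, u⟩
  have hterm : ∀ w', law ((T w').map fun t => (w', t k)) (w, u) =
      if w' = w then chan T k w u else 0 := fun w' => by
    rw [chan, law_map, law_map]
    split_ifs with hw <;> simp [hw]
  rw [law, channelPair, PMF.bind_apply, tsum_fintype, ENNReal.toReal_sum fun w' _ =>
    ENNReal.mul_ne_top (PW.apply_ne_top _) (PMF.apply_ne_top _ _)]
  simp_rw [ENNReal.toReal_mul]
  change ∑ w', law PW w' * law ((T w').map fun t => (w', t k)) (w, u) = _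
  simp [hterm, jointLaw]

lemma mutualInfo_channelPair [Fintype W] (PW : PMF W) (T : W → PMF (∀ k, U k)) (k : Fin K) :
    mutualInfo (channelPair PW T k) = info (chan T k) (law PW) / log 2 := by
  have hfst : ∀ w, ((channelPair PW T k).map Prod.fst w).toReal = law PW w := fun w => by
    refine (law_map_fst _ w).trans ?_
    simp_rw [law_channelPair, jointLaw, ← mul_sum, (chan_mem_stdSimplex T k w).2, mul_one]
  have hsnd : ∀ u, ((channelPair PW T k).map Prod.snd u).toReal =
      outLaw (chan T k) (law PW) u := fun u => by
    refine (law_map_snd _ u).trans ?_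
    simp_rw [law_channelPair, jointLaw, outLaw]
  have hjoint : ∀ w u, (channelPair PW T k (w, u)).toReal = law PW w * chan T k w u := fun w u =>
    congrFun (law_channelPair PW T k) (w, u)
  simp_rw [mutualInfo, info, relEntropy, hfst, hsnd, hjoint, mul_sum, sum_div]
  refine sum_congr rfl fun w _ => sum_congr rfl fun u _ => ?_
  rcases eq_or_ne (law PW w) 0 with hw | hw
  · simp [hw]
  · rw [mul_div_mul_left _ _ hw, logb]
    ring

variable [Fintype X] [∀ k, Fintype (Y k)]

lemma sum_law_sourcePair (P : PMF (X × (∀ k, Y k))) (k : Fin K) (x : X) :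
    ∑ y, law (sourcePair P k) (x, y) = law (P.map Prod.fst) x := by
  rw [← law_map_fst, sourcePair, PMF.map_comp]
  rfl

lemma ListCode.errorProb_eq_listErrorProb {n m : ℕ} {L : Fin K → ℕ} (C : ListCode X W Y U n m L)
    (P : PMF (X × (∀ k, Y k))) (T : W → PMF (∀ k, U k)) (k : Fin K) :
    C.errorProb P T k = listErrorProb (blockLaw (law (sourcePair P k))) (blockChannel (chan T k))
      C.encode fun u y => (C.decode k u y).1 := by
  classical
  simp_rw [listErrorProb, sum_blockLaw_mul, blockChannel, chan, sum_piLaw_map_mul, sourcePair]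
  rw [sum_piLaw_map_mul]
  simp_rw [ListCode.errorProb, mul_sum]
  refine sum_congr rfl fun s _ => sum_congr rfl fun u _ => ?_
  split_ifs
  · simp
  · rw [mul_one]
    rfl

lemma exists_superset_card_eq_min_floor {B : Type*} [Fintype B] {S : Finset B} {L : ℝ}
    (hS : (#S : ℝ) ≤ L) : ∃ S', S ⊆ S' ∧ #S' = min ⌊L⌋₊ (Fintype.card B) :=
  exists_superset_card_eq (le_min (Nat.le_floor hS) (card_le_univ S)) (min_le_right _ _)

/-- Short lists may be padded to the exact size that `ListCode` asks for. -/
lemma hasGoodCode_iff_hasBlockCode (P : PMF (X × (∀ k, Y k))) (T : W → PMF (∀ k, U k))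
    (D : Fin K → ℝ) (ε : ℝ) (n m : ℕ) :
    HasGoodCode P T D ε n m ↔ HasBlockCode (fun k => law (sourcePair P k)) (chan T)
      (fun k => D k * log 2) ε n m := by
  have hsize : ∀ k, (2 : ℝ) ^ (n * D k) = exp (n * (D k * log 2)) := fun k => by
    rw [rpow_def_of_pos two_pos]
    ring_nf
  simp_rw [HasGoodCode, HasBlockCode, ListCode.errorProb_eq_listErrorProb, hsize]
  constructor
  · rintro ⟨L, C, hC⟩
    refine ⟨C.encode, fun k u y => (C.decode k u y).1, fun k => ⟨fun u y => ?_, (hC k).2⟩⟩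
    rw [(C.decode k u y).2]
    exact (hC k).1
  · rintro ⟨enc, dec, hdec⟩
    choose pad hsub hcard using fun k u y => exists_superset_card_eq_min_floor ((hdec k).1 u y)
    refine ⟨_, ⟨enc, fun k u y => ⟨pad k u y, hcard k u y⟩⟩, fun k => ⟨?_, ?_⟩⟩
    · exact (Nat.cast_le.2 (min_le_left _ _)).trans (Nat.floor_le (exp_pos _).le)
    · exact (listErrorProb_anti (blockLaw_mem_stdSimplex (law_mem_stdSimplex _)).1
        (fun w => (blockChannel_mem_stdSimplex (chan_mem_stdSimplex T k) w).1) (hsub k)).trans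
        (hdec k).2

lemma condEntropy_sub_mul_mutualInfo_eq_div [Fintype W] (P : PMF (X × (∀ k, Y k)))
    (T : W → PMF (∀ k, U k)) (PW : PMF W) (κ : ℝ) (k : Fin K) :
    condEntropy (sourcePair P k) - κ * mutualInfo (channelPair PW T k) =
      (condEnt (law (sourcePair P k)) - κ * info (chan T k) (law PW)) / log 2 := by
  rw [condEntropy_eq_condEnt_div, mutualInfo_channelPair, mul_div_assoc', ← sub_div]

lemma cast_eq_mul_cast_of_div_eq {n m : ℕ} {κ : ℚ} (hn : n ≠ 0) (h : (m : ℚ) / n = κ) :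
    (m : ℝ) = κ * n := by
  rw [div_eq_iff (Nat.cast_ne_zero.2 hn)] at h
  exact_mod_cast congrArg (Rat.cast : ℚ → ℝ) h

lemma achievable_of_forall_max_lt [Fintype W] {P : PMF (X × (∀ k, Y k))}
    {T : W → PMF (∀ k, U k)} {κ : ℚ} {D : Fin K → ℝ} {PW : PMF W}
    (h : ∀ k, max (condEntropy (sourcePair P k) - κ * mutualInfo (channelPair PW T k)) 0 < D k) :
    Achievable P T κ D := by
  have hlog : 0 < log 2 := log_pos one_lt_two
  simp_rw [max_lt_iff, condEntropy_sub_mul_mutualInfo_eq_div, div_lt_iff₀ hlog] at h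
  intro ε hε
  have hev := eventually_hasBlockCode (fun k => law_mem_stdSimplex (sourcePair P k))
    (chan_mem_stdSimplex T) (law_mem_stdSimplex PW)
    (fun k => (mul_pos (h k).2 hlog).le) (fun k => (h k).1) hε
  obtain ⟨N, hN⟩ := eventually_atTop_prod_self.1 hev
  refine ⟨N + 1, fun n m hn hm hnm => (hasGoodCode_iff_hasBlockCode P T D ε n m).2 ?_⟩
  exact hN n m (by lia) (by lia) (cast_eq_mul_cast_of_div_eq (by lia) hnm)

lemma Achievable.weaklyAchievable {P : PMF (X × (∀ k, Y k))} {T : W → PMF (∀ k, U k)} {κ : ℚ}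
    {D : Fin K → ℝ} (h : Achievable P T κ D) (hκ : 0 < κ) : WeaklyAchievable P T κ D := by
  intro ε hε N
  obtain ⟨N₀, hN₀⟩ := h ε hε
  have hnum : (0 : ℤ) < κ.num := Rat.num_pos.2 hκ
  set t := N + N₀ + 1
  have hn : t ≤ κ.den * t := Nat.le_mul_of_pos_left _ κ.den_pos
  have hm : t ≤ κ.num.toNat * t := Nat.le_mul_of_pos_left _ (by lia)
  have hratio : ((κ.num.toNat * t : ℕ) : ℚ) / (κ.den * t : ℕ) = κ := by
    have hcast : (κ.num.toNat : ℚ) = κ.num := mod_cast Int.toNat_of_nonneg hnum.le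
    push_cast
    rw [hcast, mul_div_mul_right _ _ (by positivity), Rat.num_div_den]
  exact ⟨_, _, by lia, by lia, hratio, hN₀ _ _ (by lia) (by lia) hratio⟩

lemma WeaklyAchievable.exists_max_le [Fintype W] {P : PMF (X × (∀ k, Y k))}
    {T : W → PMF (∀ k, U k)} {κ : ℚ} {D : Fin K → ℝ} (h : WeaklyAchievable P T κ D)
    (hD : ∀ k, 0 ≤ D k) :
    ∃ PW : PMF W, ∀ k,
      max (condEntropy (sourcePair P k) - κ * mutualInfo (channelPair PW T k)) 0 ≤ D k := by
  have hlog : 0 < log 2 := log_pos one_lt_two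
  simp_rw [max_le_iff, condEntropy_sub_mul_mutualInfo_eq_div, div_le_iff₀ hlog]
  obtain ⟨v, hv, hvD⟩ := exists_condEnt_sub_le_of_hasBlockCode (κ := κ)
    (fun k => law_mem_stdSimplex (sourcePair P k)) (sum_law_sourcePair P)
    (law_mem_stdSimplex _) (chan_mem_stdSimplex T)
    (fun k => mul_nonneg (hD k) hlog.le) fun ε hε N => by
      obtain ⟨n, m, hn, hm, hnm, hcode⟩ := h ε hε (N + 1)
      exact ⟨n, by lia, m, by lia, cast_eq_mul_cast_of_div_eq (by lia) hnm,
        (hasGoodCode_iff_hasBlockCode P T D ε n m).1 hcode⟩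
  obtain ⟨PW, rfl⟩ := exists_law_eq hv
  exact ⟨PW, fun k => ⟨hvD k, hD k⟩⟩

end Model

end SWList

open SWList in
theorem lemma1 {K : ℕ} {X W : Type*} {Y U : Fin K → Type*}
    [Fintype X] [Fintype W] [∀ k, Fintype (Y k)] [∀ k, Fintype (U k)]
    (P : PMF (X × (∀ k, Y k))) (T : W → PMF (∀ k, U k))
    (κ : ℚ) (hκ : 0 < κ) (D : Fin K → ℝ) (hD : ∀ k, 0 ≤ D k) :
    ((∃ PW : PMF W, ∀ k, D k >
        max (condEntropy (sourcePair P k) - (κ : ℝ) * mutualInfo (channelPair PW T k)) 0) →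
      Achievable P T κ D) ∧
    (Achievable P T κ D → WeaklyAchievable P T κ D) ∧
    (WeaklyAchievable P T κ D →
      ∃ PW : PMF W, ∀ k, D k ≥
        max (condEntropy (sourcePair P k) - (κ : ℝ) * mutualInfo (channelPair PW T k)) 0) := by
  refine ⟨?_, fun h => h.weaklyAchievable hκ, fun h => h.exists_max_le hD⟩
  rintro ⟨PW, h⟩
  exact achievable_of_forall_max_lt h
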